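/- Let $\mathbf{CSur}$ be the category of nonempty countable sets and surjective functions. It has the right Ore property, so it carries the atomic Grothendieck topology (a sieve covers iff it is nonempty); let $\mathrm{Sh}_{at}(\mathbf{CSur})$ be the full subcategory of $[\mathbf{CSur}^{op},\mathbf{Set}]$ consisting of the sheaves for this topology (the atomic sheaves). Give $[0,1]$ its Lebesgue $\sigma$-algebra and Lebesgue measure. Let $\mathrm{Aut}[0,1]$ be the group of automorphisms of $[0,1]$ mod almost-everywhere equality: its elements are the almost-everywhere classes of measurable maps $\pi:[0,1]\to[0,1]$ that preserve and reflect negligible sets (for measurable $A$, $\pi^{-1}(A)$ is negligible iff $A$ is) and that have an inverse of the same kind mod almost-everywhere equality; multiplication is composition, $\pi\sigma=\pi\circ\sigma$. A countable measurable partition of $[0,1]$ is a partition $\mathcal A$ of $[0,1]$ into countably many measurable nonnegligible sets, and $\mathrm{Fix}\,\mathcal A$ is the subgroup of those $\pi\in\mathrm{Aut}[0,1]$ with $\pi^{-1}(A)=A$ almost everywhere (equivalently, $\pi(A)=A$ almost everywhere) for all $A\in\mathcal A$. Topologize $\mathrm{Aut}[0,1]$ by declaring $U$ to be open if for every $\pi\in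 U$ there is a countable measurable partition $\mathcal A$ of $[0,1]$ with $\pi\cdot\mathrm{Fix}\,\mathcal A\subseteq U$. A discrete probability nominal set is a set $X$ with a right action of $\mathrm{Aut}[0,1]$ such that the stabilizer of every $x\in X$ is open (that is, the action is continuous for the discrete topology on $X$). Let $\mathbf{DPNom}$ be the category of discrete probability nominal sets and equivariant functions. **Theorem.** There is an equivalence of categories $\mathrm{Sh}_{at}(\mathbf{CSur})\simeq\mathbf{DPNom}$. -/

import Mathlib

open CategoryTheory MeasureTheory

universe u

/-! ### Nonempty countable sets and surjections, and atomic sheaves on them -/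

/-- The objects of `CSur`: nonempty countable sets. -/
structure CSur : Type (u + 1) where
  carrier : Type u
  [nonempty : Nonempty carrier]
  [countable : Countable carrier]

namespace CSur

attribute [instance] nonempty countable

/-- The category of nonempty countable sets and surjective functions. -/
instance : Category.{u} CSur.{u} where
  Hom X Y := {f : X.carrier → Y.carrier // Function.Surjective f}
  id _ := ⟨id, Function.surjective_id⟩
  comp f g := ⟨g.1 ∘ f.1, g.2.comp f.2⟩

/-- `CSur` has the right Ore property, so that the atomic topology exists on it. -/
theorem rightOre : GrothendieckTopology.RightOreCondition CSur.{u} := by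
  intro X Y Z f g
  obtain ⟨y₀⟩ := Y.nonempty
  obtain ⟨z₀, h₀⟩ := g.2 (f.1 y₀)
  have : Nonempty {w : Y.carrier × Z.carrier // f.1 w.1 = g.1 w.2} := ⟨⟨(y₀, z₀), h₀.symm⟩⟩
  refine ⟨⟨{w : Y.carrier × Z.carrier // f.1 w.1 = g.1 w.2}⟩,
    ⟨fun w => w.1.1, fun y => ?_⟩, ⟨fun w => w.1.2, fun z => ?_⟩, ?_⟩
  · obtain ⟨z, hz⟩ := g.2 (f.1 y)
    exact ⟨⟨(y, z), hz.symm⟩, rfl⟩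
  · obtain ⟨y, hy⟩ := f.2 (g.1 z)
    exact ⟨⟨(y, z), hy⟩, rfl⟩
  · exact Subtype.ext (funext fun w => w.2)

end CSur

/-- The category of atomic sheaves of sets on `CSur`: the full subcategory of presheaves
that are sheaves for the atomic topology, in which every nonempty sieve covers. -/
abbrev AtomicSheafCSur : Type (u + 1) :=
  Sheaf (GrothendieckTopology.atomic CSur.rightOre.{u}) (Type u)

/-! ### The group of automorphisms of the unit interval modulo almost-everywhere equality -/

/-- The monoid (under composition) of self-maps of `[0,1]` that are Lebesgue measurable and
both preserve and reflect Lebesgue-negligible sets. The sets that are `NullMeasurableSet` with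
respect to Lebesgue measure are exactly the Lebesgue measurable ones. -/
def nonsingularMaps : Submonoid (Function.End unitInterval) where
  carrier := {f | ∀ s : Set unitInterval, NullMeasurableSet s volume →
    NullMeasurableSet (f ⁻¹' s) volume ∧ (volume (f ⁻¹' s) = 0 ↔ volume s = 0)}
  one_mem' := fun _ hs => ⟨hs, Iff.rfl⟩
  mul_mem' := fun {f g} hf hg s hs =>
    ⟨(hg (f ⁻¹' s) (hf s hs).1).1, (hg (f ⁻¹' s) (hf s hs).1).2.trans (hf s hs).2⟩

theorem nonsingularMaps_ae {f : Function.End unitInterval} (hf : f ∈ nonsingularMaps)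
    {p : unitInterval → Prop} (hp : ∀ᵐ x, p x) : ∀ᵐ x, p (f x) :=
  ((hf {x | ¬ p x} (NullMeasurableSet.of_null hp)).2).2 hp

/-- Almost-everywhere equality of nonsingular maps, a congruence for composition. -/
def aeCon : Con nonsingularMaps where
  r f g := ∀ᵐ x, f.1 x = g.1 x
  iseqv := ⟨fun _ => Filter.Eventually.of_forall fun _ => rfl,
    fun h => h.mono fun _ hx => hx.symm,
    fun h k => by filter_upwards [h, k] with x hx kx using hx.trans kx⟩
  mul' := by
    intro f f' g g' hf hg
    filter_upwards [nonsingularMaps_ae g.2 hf, hg] with x hx hx'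
    exact hx.trans (congrArg f'.1 hx')

/-- The group of automorphisms of `[0,1]` modulo almost-everywhere equality: classes `π` of
nonsingular maps that have an inverse modulo almost-everywhere equality. The product `π * σ` is
the class of the composite `π ∘ σ`. -/
abbrev AutI : Type := aeCon.Quotientˣ

/-- A countable measurable partition of `[0,1]`: a partition into countably many
Lebesgue-measurable nonnegligible sets. -/
structure CountablePartition where
  parts : Set (Set unitInterval)
  isPartition : Setoid.IsPartition parts
  countable : parts.Countable
  measurable : ∀ A ∈ parts, NullMeasurableSet A volume
  nonnegligible : ∀ A ∈ parts, volume A ≠ 0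

/-- The class `π` fixes the event `A`: `π⁻¹(A)` and `A` agree almost everywhere. -/
def FixesEvent (π : aeCon.Quotient) (A : Set unitInterval) : Prop :=
  Con.liftOn π (fun f => ∀ᵐ x, f.1 x ∈ A ↔ x ∈ A) (by
    intro f g h
    have key : ∀ f g : nonsingularMaps, (∀ᵐ x, f.1 x = g.1 x) →
        (∀ᵐ x, f.1 x ∈ A ↔ x ∈ A) → ∀ᵐ x, g.1 x ∈ A ↔ x ∈ A := by
      intro f g h hf
      filter_upwards [h, hf] with x hx hx'
      rwa [← hx]
    exact propext ⟨key f g h, key g f (aeCon.symm h)⟩)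

theorem FixesEvent.one (A : Set unitInterval) : FixesEvent 1 A :=
  Filter.Eventually.of_forall fun _ => Iff.rfl

theorem FixesEvent.mul {π σ : aeCon.Quotient} {A : Set unitInterval}
    (hπ : FixesEvent π A) (hσ : FixesEvent σ A) : FixesEvent (π * σ) A := by
  induction π using Con.induction_on with | _ f
  induction σ using Con.induction_on with | _ g
  have hf : ∀ᵐ x, f.1 x ∈ A ↔ x ∈ A := hπ
  have hg : ∀ᵐ x, g.1 x ∈ A ↔ x ∈ A := hσ
  change ∀ᵐ x, f.1 (g.1 x) ∈ A ↔ x ∈ A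
  filter_upwards [nonsingularMaps_ae g.2 hf, hg] with x hx hx'
  exact hx.trans hx'

theorem FixesEvent.of_mul_eq_one {π σ : aeCon.Quotient} {A : Set unitInterval}
    (hπ : FixesEvent π A) (h : π * σ = 1) : FixesEvent σ A := by
  induction π using Con.induction_on with | _ f
  induction σ using Con.induction_on with | _ g
  have hf : ∀ᵐ x, f.1 x ∈ A ↔ x ∈ A := hπ
  have h' : ∀ᵐ x, f.1 (g.1 x) = x := aeCon.eq.1 h
  change ∀ᵐ x, g.1 x ∈ A ↔ x ∈ A
  filter_upwards [nonsingularMaps_ae g.2 hf, h'] with x hx hx'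
  rw [hx'] at hx
  exact hx.symm

namespace CountablePartition

/-- `Fix P`: the subgroup of automorphisms that fix every element of the partition `P`. -/
def Fix (P : CountablePartition) : Subgroup AutI where
  carrier := {π | ∀ A ∈ P.parts, FixesEvent π.val A}
  one_mem' := fun A _ => FixesEvent.one A
  mul_mem' := fun hπ hσ A hA => (hπ A hA).mul (hσ A hA)
  inv_mem' := fun {π} hπ A hA => (hπ A hA).of_mul_eq_one π.mul_inv

/-- The fibers of a countably-valued function with measurable nonnegligible fibers. -/
theorem exists_of_fun {L : Type} (l : unitInterval → L) (hc : (Set.range l).Countable)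
    (hm : ∀ x, NullMeasurableSet (l ⁻¹' {l x}) volume) (h0 : ∀ x, volume (l ⁻¹' {l x}) ≠ 0) :
    ∃ P : CountablePartition, P.parts = Set.range fun x => l ⁻¹' {l x} := by
  refine ⟨⟨Set.range fun x => l ⁻¹' {l x}, ⟨?_, ?_⟩, ?_, ?_, ?_⟩, rfl⟩
  · rintro ⟨x, hx⟩
    have : x ∈ l ⁻¹' {l x} := rfl
    rw [show l ⁻¹' {l x} = ∅ from hx] at this
    exact this
  · intro a
    refine ⟨l ⁻¹' {l a}, ⟨⟨a, rfl⟩, rfl⟩, ?_⟩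
    rintro _ ⟨⟨x, rfl⟩, hx⟩
    have : l a = l x := hx
    simp [this]
  · have : (Set.range fun x => l ⁻¹' {l x}) = (fun t => l ⁻¹' {t}) '' Set.range l := by
      rw [← Set.range_comp]; rfl
    rw [this]
    exact hc.image _
  · rintro _ ⟨x, rfl⟩; exact hm x
  · rintro _ ⟨x, rfl⟩; exact h0 x

instance : Nonempty CountablePartition :=
  ⟨(exists_of_fun (fun _ => ()) (Set.to_countable _)
    (fun x => by simp)
    (fun x => by simp)).choose⟩

/-- Any two countable measurable partitions have a common refinement modulo negligible sets. -/
theorem exists_fix_le (P Q : CountablePartition) :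
    ∃ R : CountablePartition, R.Fix ≤ P.Fix ⊓ Q.Fix := by
  classical
  choose p hp hpu using P.isPartition.2
  choose q hq hqu using Q.isPartition.2
  have hpA : ∀ A ∈ P.parts, ∀ x, x ∈ A ↔ p x = A := fun A hA x =>
    ⟨fun hx => (hpu x A ⟨hA, hx⟩).symm, fun h => h ▸ (hp x).2⟩
  have hqA : ∀ A ∈ Q.parts, ∀ x, x ∈ A ↔ q x = A := fun A hA x =>
    ⟨fun hx => (hqu x A ⟨hA, hx⟩).symm, fun h => h ▸ (hq x).2⟩
  let l : unitInterval → Set unitInterval × Set unitInterval := fun x => (p x, q x)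
  have lc : (Set.range l).Countable :=
    (P.countable.prod Q.countable).mono (by rintro _ ⟨x, rfl⟩; exact ⟨(hp x).1, (hq x).1⟩)
  have lm : ∀ x, NullMeasurableSet (l ⁻¹' {l x}) volume := by
    intro x
    have : l ⁻¹' {l x} = p x ∩ q x := by
      ext y
      rw [Set.mem_inter_iff, hpA _ (hp x).1, hqA _ (hq x).1]
      simp [l]
    rw [this]
    exact (P.measurable _ (hp x).1).inter (Q.measurable _ (hq x).1)
  have good : ∀ᵐ x, volume (l ⁻¹' {l x}) ≠ 0 := by
    have : volume (⋃ t ∈ {t ∈ Set.range l | volume (l ⁻¹' {t}) = 0}, l ⁻¹' {t}) = 0 :=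
      (measure_biUnion_null_iff (lc.mono fun _ h => h.1)).2 fun t ht => ht.2
    refine measure_mono_null (fun x hx => ?_) this
    have hx' : volume (l ⁻¹' {l x}) = 0 := not_not.1 hx
    exact Set.mem_biUnion (x := l x) ⟨⟨x, rfl⟩, hx'⟩ rfl
  obtain ⟨x₀, hx₀⟩ := good.exists
  let m : unitInterval → Set unitInterval × Set unitInterval :=
    fun x => if volume (l ⁻¹' {l x}) = 0 then l x₀ else l x
  have mrange : ∀ x, ∃ y, m x = l y ∧ volume (l ⁻¹' {l y}) ≠ 0 := by
    intro x
    by_cases h : volume (l ⁻¹' {l x}) = 0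
    · exact ⟨x₀, by simp [m, h], hx₀⟩
    · exact ⟨x, by simp [m, h], h⟩
  have ml : ∀ᵐ x, m x = l x := good.mono fun x hx => by simp [m, hx]
  have mfib : ∀ t, (m ⁻¹' {t} : Set unitInterval) =ᵐ[volume] (l ⁻¹' {t} : Set unitInterval) := by
    intro t
    filter_upwards [ml] with x hx
    change (m x = t) = (l x = t)
    rw [hx]
  obtain ⟨R, hR⟩ := exists_of_fun m
    (lc.mono (by rintro _ ⟨x, rfl⟩; obtain ⟨y, hy, -⟩ := mrange x; exact ⟨y, hy.symm⟩))
    (fun x => by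
      obtain ⟨y, hy, -⟩ := mrange x
      rw [hy]; exact (lm y).congr (mfib _).symm)
    (fun x => by
      obtain ⟨y, hy, h⟩ := mrange x
      rw [hy, measure_congr (mfib _)]; exact h)
  refine ⟨R, fun π hπ => ?_⟩
  rw [Subgroup.mem_inf]
  change (∀ A ∈ P.parts, FixesEvent π.val A) ∧ ∀ A ∈ Q.parts, FixesEvent π.val A
  change ∀ A ∈ R.parts, FixesEvent π.val A at hπ
  generalize π.val = c at hπ ⊢
  induction c using Con.induction_on with | _ f
  have hπ' : ∀ A ∈ R.parts, ∀ᵐ x, f.1 x ∈ A ↔ x ∈ A := hπ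
  have hall := (ae_ball_iff R.countable).2 hπ'
  have hl : ∀ᵐ x, l (f.1 x) = l x := by
    filter_upwards [hall, ml, nonsingularMaps_ae f.2 ml] with x hx h1 h2
    have := (hx (m ⁻¹' {m x}) (by rw [hR]; exact ⟨x, rfl⟩)).2 rfl
    rw [← h1, ← h2]
    exact this
  constructor
  · intro A hA
    change ∀ᵐ x, f.1 x ∈ A ↔ x ∈ A
    filter_upwards [hl] with x hx
    rw [hpA A hA, hpA A hA, show p (f.1 x) = p x from congrArg Prod.fst hx]
  · intro A hA
    change ∀ᵐ x, f.1 x ∈ A ↔ x ∈ A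
    filter_upwards [hl] with x hx
    rw [hqA A hA, hqA A hA, show q (f.1 x) = q x from congrArg Prod.snd hx]

end CountablePartition

/-- The topology on the automorphism group generated by countable measurable partitions: a set
`U` is open if every `π ∈ U` has `π · Fix P ⊆ U` for some countable measurable partition `P`. -/
instance : TopologicalSpace AutI where
  IsOpen U := ∀ π ∈ U, ∃ P : CountablePartition, ∀ σ ∈ P.Fix, π * σ ∈ U
  isOpen_univ := fun _ _ => ⟨Classical.arbitrary _, fun _ _ => trivial⟩
  isOpen_inter := by
    intro U V hU hV π hπ
    obtain ⟨P, hP⟩ := hU π hπ.1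
    obtain ⟨Q, hQ⟩ := hV π hπ.2
    obtain ⟨R, hR⟩ := P.exists_fix_le Q
    exact ⟨R, fun σ hσ => ⟨hP σ (hR hσ).1, hQ σ (hR hσ).2⟩⟩
  isOpen_sUnion := by
    intro S hS π hπ
    obtain ⟨U, hU, hπU⟩ := hπ
    obtain ⟨P, hP⟩ := hS U hU π hπU
    exact ⟨P, fun σ hσ => ⟨U, hU, hP σ hσ⟩⟩

/-! ### Discrete probability nominal sets -/

/-- A discrete probability nominal set: a set with a right action of `AutI` (that is, an action
of the opposite group, `x · π` being `MulOpposite.op π • x`) whose elements have open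
stabilizers. -/
structure DiscreteProbNominalSet : Type (u + 1) where
  carrier : Type u
  [action : MulAction AutIᵐᵒᵖ carrier]
  isOpen_stabilizer : ∀ x : carrier, IsOpen {π : AutI | MulOpposite.op π • x = x}

namespace DiscreteProbNominalSet

attribute [instance] action

/-- The category of discrete probability nominal sets and equivariant functions. -/
instance : Category.{u} DiscreteProbNominalSet.{u} where
  Hom X Y := X.carrier →[AutIᵐᵒᵖ] Y.carrier
  id X := MulActionHom.id AutIᵐᵒᵖ
  comp f g := MulActionHom.comp g f

end DiscreteProbNominalSet

/-! ### Isomorphism of nonnegligible events modulo negligible sets -/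

/-! The interval behaves like a universal homogeneous cover of all nonempty countable sets. Write
`RandomSurj S` for the classes of measurable maps from `[0,1]` to `S` with nonnegligible fibers.
Five facts carry the proof: it is nonempty (`RandomSurj.nonempty`); its elements are epimorphisms
(`eq_of_map_eq`); any two have a common refinement (`exists_refinement`); automorphisms act
transitively on it (`exists_smul_eq`); and the stabilizers of its elements are cofinal with the
subgroups `Fix P` (`exists_fix_le_stabilizer`, `exists_stabilizer_le_fix`). The analytic input is
transitivity: nonnegligible events are isomorphic mod null sets (`exists_iso_events`, via
distribution functions), and such isomorphisms glue over countably many fibers.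

The rest is formal, in the style of Galois theory. A nominal set `X` gives the sheaf of equivariant
maps from `RandomSurj S` to `X`; as `RandomSurj S` is one orbit, its sections are the points of `X`
fixed by the stabilizer of a chosen `p`. Every point arises so, which makes this `nerve` fully
faithful. Conversely, a sheaf `F` has a stalk at `[0,1]`, and descent shows that the germs fixed by
the stabilizer of `p` are exactly the sections along `p`, so `F` is the nerve of its stalk. -/

open unitInterval in
/-- A probability measure on the unit interval that is dominated by a multiple of Lebesgue measure
is isomorphic to Lebesgue measure modulo negligible sets. -/
theorem exists_iso_volume (μ : Measure I) [IsProbabilityMeasure μ] (c : NNReal)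
    (hc : ∀ s, μ s ≤ c * volume s) :
    ∃ F G : I → I, MeasurePreserving F μ volume ∧ MeasurePreserving G volume μ ∧
      (∀ᵐ x ∂μ, G (F x) = x) ∧ ∀ t, F (G t) = t := by
  -- The distribution function of `μ`; domination by Lebesgue measure makes it Lipschitz, hence
  -- continuous and onto.
  let F : I → I := fun x => ⟨μ.real (Set.Iic x), measureReal_nonneg, measureReal_le_one⟩
  have Fmono : Monotone F := fun x y h => measureReal_mono (Set.Iic_subset_Iic.2 h)
  have Flip : LipschitzWith c fun x => (F x : ℝ) := by
    refine LipschitzWith.of_le_add_mul c fun x y => ?_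
    rcases le_total x y with h | h
    · have h1 : (F x : ℝ) ≤ F y := Fmono h
      exact h1.trans (le_add_of_nonneg_right (by positivity))
    · have h1 : μ.real (Set.Iic x) ≤ μ.real (Set.Iic y) + μ.real (Set.Ioc y x) := by
        rw [← Set.Iic_union_Ioc_eq_Iic h]
        exact measureReal_union_le _ _
      have h2 : μ.real (Set.Ioc y x) ≤ c * dist x y := by
        refine ENNReal.toReal_le_of_le_ofReal (by positivity) ((hc _).trans ?_)
        rw [unitInterval.volume_Ioc, ENNReal.ofReal_mul (by positivity), ENNReal.ofReal_coe_nnreal]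
        gcongr
        rw [Subtype.dist_eq, Real.dist_eq]
        exact le_abs_self _
      exact h1.trans (by gcongr)
  have Fcont : Continuous F := Flip.continuous.subtype_mk _
  have null : ∀ x, μ {x} = 0 := fun x => le_antisymm ((hc _).trans (by simp)) zero_le
  have F0 : F 0 = 0 := by
    refine Subtype.ext ?_
    have : Set.Iic (0 : I) = {0} := Set.Iic_bot
    simp [F, this, Measure.real, null]
  have F1 : F 1 = 1 := by
    refine Subtype.ext ?_
    have : Set.Iic (1 : I) = Set.univ := Set.Iic_top
    simp [F, this]
  have Fsurj : Function.Surjective F := by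
    intro t
    have := intermediate_value_Icc (zero_le_one' I) Fcont.continuousOn
    rw [F0, F1] at this
    obtain ⟨x, -, hx⟩ := this ⟨t.2.1, t.2.2⟩
    exact ⟨x, hx⟩
  have Fval : ∀ x, μ (Set.Iic x) = ENNReal.ofReal (F x) := fun x =>
    (ENNReal.ofReal_toReal (measure_ne_top _ _)).symm
  have Fpres : MeasurePreserving F μ volume := by
    refine ⟨Fcont.measurable, ?_⟩
    have := Measure.isProbabilityMeasure_map (μ := μ) Fcont.aemeasurable
    refine Measure.ext_of_Iic _ _ fun t => ?_
    rw [Measure.map_apply Fcont.measurable measurableSet_Iic, unitInterval.volume_Iic]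
    obtain ⟨x, hx⟩ := Fsurj t
    -- The sublevel set is an initial segment ending at its largest point `y`, where `F` takes the
    -- value `t`.
    obtain ⟨y, hy, hymax⟩ := ((isClosed_Iic (a := t)).preimage Fcont).isCompact.exists_isGreatest
      ⟨x, hx.le⟩
    have : F ⁻¹' Set.Iic t = Set.Iic y :=
      Set.Subset.antisymm (fun z hz => hymax hz) fun z hz => (Fmono hz).trans hy
    rw [this, Fval, le_antisymm hy (hx.symm.le.trans (Fmono (hymax hx.le)))]
  -- Any right inverse of a monotone map is monotone, so an arbitrary choice is measurable.
  obtain ⟨G, hG⟩ := Fsurj.hasRightInverse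
  have Gmono : Monotone G := fun s t h => by
    by_contra! hlt
    have := Fmono hlt.le
    rw [hG, hG] at this
    rw [le_antisymm h this] at hlt
    exact lt_irrefl _ hlt
  have GF : ∀ᵐ x ∂μ, G (F x) = x := by
    -- A monotone function has only countably many values with more than one preimage.
    have h0 : volume {t : I | ∃ x y, x < y ∧ F x = t ∧ F y = t} = 0 :=
      Fmono.countable_setOfPred_two_preimages.measure_zero _
    have h1 := Fpres.quasiMeasurePreserving.ae (p := fun t => ¬ ∃ x y, x < y ∧ F x = t ∧ F y = t)
      (by rw [ae_iff]; simpa only [not_not] using h0)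
    filter_upwards [h1] with x hx
    by_contra hne
    rcases lt_or_gt_of_ne hne with h | h
    · exact hx ⟨_, _, h, hG _, rfl⟩
    · exact hx ⟨_, _, h, rfl, hG _⟩
  refine ⟨F, G, Fpres, ⟨Gmono.measurable, ?_⟩, GF, hG⟩
  rw [← Fpres.map_eq, Measure.map_map Gmono.measurable Fcont.measurable]
  exact (Measure.map_congr (g := id) GF).trans Measure.map_id

open unitInterval ProbabilityTheory in
/-- Any two nonnegligible events are isomorphic modulo negligible sets. -/
theorem exists_iso_events {A B : Set I} (hA : volume A ≠ 0) (hB : volume B ≠ 0) :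
    ∃ S T : I → I, Measure.QuasiMeasurePreserving S (volume.restrict A) (volume.restrict B) ∧
      Measure.QuasiMeasurePreserving T (volume.restrict B) (volume.restrict A) ∧
      (∀ᵐ x ∂volume.restrict A, T (S x) = x) ∧ ∀ᵐ x ∂volume.restrict B, S (T x) = x := by
  have key : ∀ {A : Set I}, volume A ≠ 0 → ∃ F G : I → I,
      Measure.QuasiMeasurePreserving F (volume.restrict A) volume ∧
      Measure.QuasiMeasurePreserving G volume (volume.restrict A) ∧
      (∀ᵐ x ∂volume.restrict A, G (F x) = x) ∧ ∀ t, F (G t) = t := by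
    intro A hA
    have := cond_isProbabilityMeasure hA
    obtain ⟨F, G, hF, hG, h, h'⟩ := exists_iso_volume (volume[|A]) ((volume A)⁻¹.toNNReal) (by
      intro s
      rw [ENNReal.coe_toNNReal (ENNReal.inv_ne_top.2 hA), ProbabilityTheory.cond,
        Measure.smul_apply, smul_eq_mul]
      gcongr
      exact Measure.restrict_le_self)
    have h1 : volume.restrict A ≪ volume[|A] :=
      Measure.absolutelyContinuous_smul (ENNReal.inv_ne_zero.2 (measure_ne_top _ _))
    have h2 : volume[|A] ≪ volume.restrict A := Measure.smul_absolutelyContinuous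
    exact ⟨F, G, hF.quasiMeasurePreserving.mono_left h1, hG.quasiMeasurePreserving.mono_right h2,
      h1.ae_le h, h'⟩
  obtain ⟨F, G, hF, hG, h, h'⟩ := key hA
  obtain ⟨F', G', hF', hG', k, k'⟩ := key hB
  refine ⟨G' ∘ F, G ∘ F', hG'.comp hF, hG.comp hF', ?_, ?_⟩
  · filter_upwards [h] with x hx
    simp [k', hx]
  · filter_upwards [k] with x hx
    simp [h', hx]

/-- There are measurable functions from the unit interval to `ℕ` with nonnegligible fibers. -/
theorem exists_measurable_nat :
    ∃ f : unitInterval → ℕ, Measurable f ∧ ∀ n, volume (f ⁻¹' {n}) ≠ 0 := by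
  -- The fiber over `n` contains the interval from `1/(n+2)` (excluded) to `1/(n+1)`; the point `0`
  -- lands harmlessly in the fiber over `0`.
  refine ⟨fun x => ⌊(x : ℝ)⁻¹⌋₊ - 1, ?_, fun n => ?_⟩
  · exact (measurable_from_nat (f := fun n => n - 1)).comp
      (Nat.measurable_floor.comp measurable_subtype_coe.inv)
  · have h1 : ((n : ℝ) + 2)⁻¹ < ((n : ℝ) + 1)⁻¹ := by gcongr; norm_num
    let a : unitInterval := ⟨((n : ℝ) + 2)⁻¹, by positivity,
      inv_le_one_of_one_le₀ (by linarith [n.cast_nonneg (α := ℝ)])⟩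
    let b : unitInterval := ⟨((n : ℝ) + 1)⁻¹, by positivity,
      inv_le_one_of_one_le₀ (by linarith [n.cast_nonneg (α := ℝ)])⟩
    have h2 : volume (Set.Ioc a b) ≠ 0 := by
      rw [unitInterval.volume_Ioc]
      simpa [a, b] using h1
    refine fun h => h2 (measure_mono_null (fun x hx => ?_) h)
    have hx1 : ((n : ℝ) + 2)⁻¹ < x := hx.1
    have hx2 : (x : ℝ) ≤ ((n : ℝ) + 1)⁻¹ := hx.2
    have hx0 : (0 : ℝ) < x := lt_of_le_of_lt (by positivity) hx1
    have : ⌊(x : ℝ)⁻¹⌋₊ = n + 1 := by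
      rw [Nat.floor_eq_iff (by positivity)]
      push_cast
      exact ⟨(le_inv_comm₀ hx0 (by positivity)).1 hx2,
        by rw [add_assoc, one_add_one_eq_two]; exact (inv_lt_comm₀ (by positivity) hx0).1 hx1⟩
    simp [this]

/-! ### Random surjections -/

/-- A measurable function from `[0,1]` with nonnegligible fibers. -/
def IsRandomSurj {S : Type u} (p : unitInterval → S) : Prop :=
  ∀ s, NullMeasurableSet (p ⁻¹' {s}) volume ∧ volume (p ⁻¹' {s}) ≠ 0

theorem IsRandomSurj.nullMeasurableSet {S : Type u} [Countable S] {p : unitInterval → S}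
    (hp : IsRandomSurj p) (A : Set S) : NullMeasurableSet (p ⁻¹' A) volume := by
  rw [← Set.biUnion_preimage_singleton]
  exact NullMeasurableSet.biUnion A.to_countable fun s _ => (hp s).1

theorem IsRandomSurj.comp_surjective {S T : Type u} [Countable S] {p : unitInterval → S}
    (hp : IsRandomSurj p) {f : S → T} (hf : f.Surjective) : IsRandomSurj (f ∘ p) := by
  intro t
  refine ⟨hp.nullMeasurableSet (f ⁻¹' {t}), fun h => ?_⟩
  obtain ⟨s, rfl⟩ := hf t
  exact (hp s).2 (measure_mono_null (fun x hx => congrArg f hx) h)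

theorem IsRandomSurj.comp_nonsingular {S : Type u} {p : unitInterval → S}
    (hp : IsRandomSurj p) (f : nonsingularMaps) : IsRandomSurj (p ∘ f.1) := fun s =>
  ⟨(f.2 _ (hp s).1).1, fun h => (hp s).2 ((f.2 _ (hp s).1).2.1 h)⟩

/-- Almost-everywhere equality of random surjections. -/
def randomSurjSetoid (S : Type u) : Setoid {p : unitInterval → S // IsRandomSurj p} where
  r p q := ∀ᵐ x, p.1 x = q.1 x
  iseqv := ⟨fun _ => Filter.Eventually.of_forall fun _ => rfl,
    fun h => h.mono fun _ hx => hx.symm,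
    fun h k => by filter_upwards [h, k] with x hx kx using hx.trans kx⟩

/-- A random surjection onto `S`: an almost-everywhere class of measurable functions
`[0,1] → S` with nonnegligible fibers. -/
def RandomSurj (S : Type u) : Type u := Quotient (randomSurjSetoid S)

namespace RandomSurj

variable {S T : Type u}

/-- The class of a measurable function with nonnegligible fibers. -/
def mk (p : unitInterval → S) (hp : IsRandomSurj p) : RandomSurj S :=
  Quotient.mk (randomSurjSetoid S) ⟨p, hp⟩

theorem exists_rep (p : RandomSurj S) : ∃ (f : unitInterval → S) (hf : IsRandomSurj f),
    p = mk f hf := by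
  induction p using Quotient.inductionOn with | _ p
  exact ⟨p.1, p.2, rfl⟩

theorem mk_eq_mk {p q : unitInterval → S} {hp : IsRandomSurj p} {hq : IsRandomSurj q} :
    mk p hp = mk q hq ↔ ∀ᵐ x, p x = q x :=
  Quotient.eq (r := randomSurjSetoid S)

/-- Postcomposition with a surjection. -/
def map [Countable S] (f : S → T) (hf : f.Surjective) : RandomSurj S → RandomSurj T :=
  Quotient.lift (fun p => mk (f ∘ p.1) (p.2.comp_surjective hf)) fun _ _ h =>
    mk_eq_mk.2 (h.mono fun _ hx => congrArg f hx)

theorem map_mk [Countable S] {f : S → T} {hf : f.Surjective} {p : unitInterval → S}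
    {hp : IsRandomSurj p} : map f hf (mk p hp) = mk (f ∘ p) (hp.comp_surjective hf) := rfl

/-- Precomposition with a nonsingular map. -/
def comp (p : RandomSurj S) (c : aeCon.Quotient) : RandomSurj S :=
  Con.liftOn c (fun f => Quotient.map (sa := randomSurjSetoid S) (sb := randomSurjSetoid S)
      (fun p => ⟨p.1 ∘ f.1, p.2.comp_nonsingular f⟩) (fun _ _ h => nonsingularMaps_ae f.2 h) p)
    (by
      intro f g h
      induction p using Quotient.inductionOn with | _ p
      exact Quotient.sound (s := randomSurjSetoid S) (h.mono fun x hx => congrArg p.1 hx))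

theorem comp_coe {p : unitInterval → S} {hp : IsRandomSurj p} (f : nonsingularMaps) :
    comp (mk p hp) (f : aeCon.Quotient) = mk (p ∘ f.1) (hp.comp_nonsingular f) := rfl

/-- The right action of automorphisms on random surjections by precomposition. -/
instance : MulAction AutIᵐᵒᵖ (RandomSurj S) where
  smul g p := p.comp g.unop.val
  one_smul p := by
    induction p using Quotient.inductionOn with | _ p
    rfl
  mul_smul g h p := by
    change p.comp (h.unop.val * g.unop.val) = (p.comp h.unop.val).comp g.unop.val
    generalize h.unop.val = c, g.unop.val = d
    induction c using Con.induction_on with | _ c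
    induction d using Con.induction_on with | _ d
    induction p using Quotient.inductionOn with | _ p
    rfl

theorem smul_def (g : AutIᵐᵒᵖ) (p : RandomSurj S) : g • p = p.comp g.unop.val := rfl

theorem map_smul_eq [Countable S] (f : S → T) (hf : f.Surjective) (g : AutIᵐᵒᵖ) (p : RandomSurj S) :
    map f hf (g • p) = g • map f hf p := by
  rw [smul_def, smul_def]
  generalize g.unop.val = c
  induction c using Con.induction_on with | _ c
  induction p using Quotient.inductionOn with | _ p
  rfl

theorem map_id [Countable S] (p : RandomSurj S) : map id Function.surjective_id p = p := by
  induction p using Quotient.inductionOn with | _ p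
  rfl

theorem map_map {U : Type u} [Countable S] [Countable T] (f : S → T) (hf : f.Surjective)
    (g : T → U) (hg : g.Surjective) (p : RandomSurj S) :
    map g hg (map f hf p) = map (g ∘ f) (hg.comp hf) p := by
  induction p using Quotient.inductionOn with | _ p
  rfl

/-- A random surjection is an epimorphism. -/
theorem eq_of_map_eq [Countable S] {f g : S → T} {hf : f.Surjective} {hg : g.Surjective}
    {p : RandomSurj S} (h : map f hf p = map g hg p) : f = g := by
  obtain ⟨p, hp, rfl⟩ := p.exists_rep
  rw [map_mk, map_mk, mk_eq_mk] at h
  funext s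
  by_contra hne
  refine (hp s).2 (measure_mono_null (fun x hx => ?_) h)
  obtain rfl : p x = s := hx
  exact hne

/-- Supplies the base point that, with transitivity, makes `RandomSurj S` exactly one orbit. -/
theorem nonempty [Nonempty S] [Countable S] : Nonempty (RandomSurj S) := by
  obtain ⟨f, hf⟩ := exists_surjective_nat S
  obtain ⟨p, hp, h0⟩ := exists_measurable_nat
  have : IsRandomSurj p := fun n => ⟨(hp (measurableSet_singleton n)).nullMeasurableSet, h0 n⟩
  refine ⟨mk (f ∘ p) fun s => ⟨this.nullMeasurableSet (f ⁻¹' {s}), fun h => ?_⟩⟩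
  obtain ⟨n, rfl⟩ := hf s
  exact h0 n (measure_mono_null (fun x hx => congrArg f hx) h)

/-- Any two random surjections have a common refinement. -/
theorem exists_refinement [Countable S] [Countable T] (p : RandomSurj S) (q : RandomSurj T) :
    ∃ (R : Type u) (_ : Nonempty R) (_ : Countable R) (r : RandomSurj R)
      (f : R → S) (hf : f.Surjective) (g : R → T) (hg : g.Surjective),
      map f hf r = p ∧ map g hg r = q := by
  classical
  obtain ⟨p, hp, rfl⟩ := p.exists_rep
  obtain ⟨q, hq, rfl⟩ := q.exists_rep
  -- Only pairs of nonnegligible joint probability are kept; the points with a discarded pair form a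
  -- null set and get the default value at `x₀`.
  let R := {w : S × T // volume (p ⁻¹' {w.1} ∩ q ⁻¹' {w.2}) ≠ 0}
  have good : ∀ᵐ x, volume (p ⁻¹' {p x} ∩ q ⁻¹' {q x}) ≠ 0 := by
    have : volume (⋃ w : {w : S × T // volume (p ⁻¹' {w.1} ∩ q ⁻¹' {w.2}) = 0},
        p ⁻¹' {w.1.1} ∩ q ⁻¹' {w.1.2}) = 0 := measure_iUnion_null fun w => w.2
    refine measure_mono_null (fun x hx => ?_) this
    exact Set.mem_iUnion.2 ⟨⟨(p x, q x), not_not.1 hx⟩, rfl, rfl⟩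
  obtain ⟨x₀, hx₀⟩ := good.exists
  let r : unitInterval → R := fun x =>
    if h : volume (p ⁻¹' {p x} ∩ q ⁻¹' {q x}) ≠ 0 then ⟨(p x, q x), h⟩ else ⟨(p x₀, q x₀), hx₀⟩
  have hr : ∀ᵐ x, (r x).1 = (p x, q x) := good.mono fun x hx => by simp only [r, dif_pos hx]
  have hrS : IsRandomSurj r := by
    intro w
    have : (p ⁻¹' {w.1.1} ∩ q ⁻¹' {w.1.2} : Set unitInterval) =ᵐ[volume] r ⁻¹' {w} := by
      filter_upwards [hr] with x hx
      refine propext (Iff.trans ?_ (Subtype.ext_iff (a1 := r x) (a2 := w)).symm)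
      rw [hx, Prod.ext_iff]
      rfl
    exact ⟨((hp _).1.inter (hq _).1).congr this, by rw [← measure_congr this]; exact w.2⟩
  -- If `f` missed a value, the fiber of `t` over it would be null.
  have surj : ∀ {U : Type u} {t : unitInterval → U} (_ : IsRandomSurj t) (f : R → U),
      (∀ᵐ x, f (r x) = t x) → f.Surjective := by
    intro U t ht f hf u
    by_contra! hu
    refine (ht u).2 (measure_mono_null (fun x hx => ?_) hf)
    intro h
    exact hu (r x) (h.trans hx)
  have hf : ∀ᵐ x, (r x).1.1 = p x := hr.mono fun x hx => congrArg Prod.fst hx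
  have hg : ∀ᵐ x, (r x).1.2 = q x := hr.mono fun x hx => congrArg Prod.snd hx
  exact ⟨R, ⟨⟨(p x₀, q x₀), hx₀⟩⟩, inferInstance, mk r hrS, fun w => w.1.1, surj hp _ hf, fun w => w.1.2,
    surj hq _ hg, mk_eq_mk.2 hf, mk_eq_mk.2 hg⟩

/-- Gluing isomorphisms between the fibers of two random surjections. -/
theorem exists_nonsingular [Countable S] {p q : unitInterval → S} (hp : IsRandomSurj p)
    (hq : IsRandomSurj q) (T : S → unitInterval → unitInterval)
    (hT : ∀ s, Measure.QuasiMeasurePreserving (T s) (volume.restrict (q ⁻¹' {s}))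
      (volume.restrict (p ⁻¹' {s})))
    (T' : S → unitInterval → unitInterval)
    (hT' : ∀ s, Measure.QuasiMeasurePreserving (T' s) (volume.restrict (p ⁻¹' {s}))
      (volume.restrict (q ⁻¹' {s})))
    (h : ∀ s, ∀ᵐ x ∂volume.restrict (p ⁻¹' {s}), T s (T' s x) = x) :
    (fun x => T (q x) x) ∈ nonsingularMaps ∧ (∀ᵐ x, p (T (q x) x) = q x) ∧
      ∀ᵐ x, T (q (T' (p x) x)) (T' (p x) x) = x := by
  have glue : ∀ {p : unitInterval → S} (hp : IsRandomSurj p) {P : S → unitInterval → Prop},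
      (∀ s, ∀ᵐ x ∂volume.restrict (p ⁻¹' {s}), P s x) → ∀ᵐ x, P (p x) x := by
    intro p hp P h
    have := ae_all_iff.2 fun s => (ae_restrict_iff'₀ (hp s).1).1 (h s)
    exact this.mono fun x hx => hx (p x) rfl
  have hmem : ∀ {p q : unitInterval → S} (hp : IsRandomSurj p)
      (T : S → unitInterval → unitInterval) (_ : ∀ s, Measure.QuasiMeasurePreserving (T s)
        (volume.restrict (q ⁻¹' {s})) (volume.restrict (p ⁻¹' {s}))) (s : S),
      ∀ᵐ x ∂volume.restrict (q ⁻¹' {s}), p (T s x) = s := fun hp T hT s =>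
    (hT s).ae (ae_restrict_mem₀ (hp s).1)
  have hTT' : ∀ᵐ x, T (q (T' (p x) x)) (T' (p x) x) = x := by
    refine glue hp (P := fun s x => T (q (T' s x)) (T' s x) = x) fun s => ?_
    filter_upwards [h s, hmem hq T' hT' s] with x hx hx'
    rw [hx', hx]
  refine ⟨fun C hC => ⟨?_, fun h0 => ?_, fun h0 => ?_⟩, glue hq (hmem hp T hT), hTT'⟩
  · have : (fun x => T (q x) x) ⁻¹' C = ⋃ s, T s ⁻¹' C ∩ q ⁻¹' {s} := by
      ext x; simp
    rw [this]
    refine NullMeasurableSet.iUnion fun s => ?_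
    rw [← nullMeasurableSet_restrict (hq s).1]
    exact (hC.mono_ac Measure.absolutelyContinuous_restrict).preimage (hT s)
  · have h1 : ∀ᵐ x, T (q x) x ∉ C := measure_eq_zero_iff_ae_notMem.1 h0
    -- Null sets are reflected by pulling back along the glued inverse.
    have h2 : ∀ᵐ x, T (q (T' (p x) x)) (T' (p x) x) ∉ C :=
      glue hp (P := fun s x => T (q (T' s x)) (T' s x) ∉ C) fun s =>
        (hT' s).ae (ae_restrict_of_ae h1)
    refine measure_eq_zero_iff_ae_notMem.2 ?_
    filter_upwards [h2, hTT'] with x hx hx'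
    rwa [hx'] at hx
  · refine measure_eq_zero_iff_ae_notMem.2 ?_
    exact glue hq (P := fun s x => T s x ∉ C) fun s =>
      (hT s).ae (ae_restrict_of_ae (measure_eq_zero_iff_ae_notMem.1 h0))

/-- Automorphisms act transitively on random surjections onto a countable set. -/
theorem exists_smul_eq [Countable S] (p q : RandomSurj S) : ∃ g : AutIᵐᵒᵖ, g • p = q := by
  obtain ⟨p, hp, rfl⟩ := p.exists_rep
  obtain ⟨q, hq, rfl⟩ := q.exists_rep
  choose T' T hT' hT h h' using fun s => exists_iso_events (hp s).2 (hq s).2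
  obtain ⟨m, e, i⟩ := exists_nonsingular hp hq T hT T' hT' h
  obtain ⟨m', -, i'⟩ := exists_nonsingular hq hp T' hT' T hT h'
  let π : AutI := ⟨((⟨_, m⟩ : nonsingularMaps) : aeCon.Quotient),
    ((⟨_, m'⟩ : nonsingularMaps) : aeCon.Quotient), aeCon.eq.2 i, aeCon.eq.2 i'⟩
  exact ⟨MulOpposite.op π, mk_eq_mk.2 e⟩

/-- Random surjections lift along surjections. -/
theorem map_surjective [Countable S] [Nonempty S] [Countable T] (f : S → T) (hf : f.Surjective) :
    (map f hf).Surjective := by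
  intro q
  obtain ⟨p⟩ := nonempty (S := S)
  obtain ⟨g, hg⟩ := exists_smul_eq (map f hf p) q
  exact ⟨g • p, by rw [map_smul_eq, hg]⟩

/-- The stabilizer of a random surjection contains the automorphisms fixing its fibers. -/
theorem exists_fix_le_stabilizer [Countable S] (p : RandomSurj S) :
    ∃ P : CountablePartition, ∀ π ∈ P.Fix, MulOpposite.op π • p = p := by
  obtain ⟨p, hp, rfl⟩ := p.exists_rep
  -- Relabelling by natural numbers moves the labels to the universe required by `exists_of_fun`
  -- without changing the fibers.
  obtain ⟨e, he⟩ := exists_injective_nat S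
  have hfib : ∀ x, (e ∘ p) ⁻¹' {(e ∘ p) x} = p ⁻¹' {p x} := fun x => by
    ext y; simp [he.eq_iff]
  obtain ⟨P, hP⟩ := CountablePartition.exists_of_fun (e ∘ p) (Set.to_countable _)
    (fun x => by rw [hfib]; exact (hp _).1) (fun x => by rw [hfib]; exact (hp _).2)
  refine ⟨P, fun π hπ => ?_⟩
  change ∀ A ∈ P.parts, FixesEvent π.val A at hπ
  rw [smul_def, MulOpposite.unop_op]
  generalize π.val = c at hπ ⊢
  induction c using Con.induction_on with | _ f
  have hall : ∀ᵐ x, ∀ A ∈ P.parts, f.1 x ∈ A ↔ x ∈ A := (ae_ball_iff P.countable).2 hπ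
  rw [comp_coe, mk_eq_mk]
  filter_upwards [hall] with x hx
  refine (hx (p ⁻¹' {p x}) ?_).2 rfl
  rw [hP, ← hfib]
  exact ⟨x, rfl⟩

/-- Every countable measurable partition consists of the fibers of a random surjection. -/
theorem exists_stabilizer_le_fix (P : CountablePartition) :
    ∃ (S : Type u) (_ : Nonempty S) (_ : Countable S) (p : RandomSurj S),
      ∀ π : AutI, MulOpposite.op π • p = p → π ∈ P.Fix := by
  choose c hc hcu using P.isPartition.2
  have : Countable P.parts := P.countable.to_subtype
  let p : unitInterval → ULift.{u} P.parts := fun x => ⟨⟨c x, (hc x).1⟩⟩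
  have mem : ∀ (A : P.parts) x, p x = ⟨A⟩ ↔ x ∈ A.1 := by
    intro A x
    rw [ULift.ext_iff, Subtype.ext_iff]
    exact ⟨fun h => h ▸ (hc x).2, fun h => (hcu x A ⟨A.2, h⟩).symm⟩
  have fib : ∀ A : ULift.{u} P.parts, p ⁻¹' {A} = A.down.1 := fun A => by
    ext x; exact mem A.down x
  have hp : IsRandomSurj p := fun A => by
    rw [fib]; exact ⟨P.measurable _ A.down.2, P.nonnegligible _ A.down.2⟩
  refine ⟨_, ⟨p 0⟩, inferInstance, mk p hp, fun π hπ A hA => ?_⟩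
  rw [smul_def, MulOpposite.unop_op] at hπ
  generalize π.val = d at hπ ⊢
  induction d using Con.induction_on with | _ f
  rw [comp_coe, mk_eq_mk] at hπ
  change ∀ᵐ x, f.1 x ∈ A ↔ x ∈ A
  filter_upwards [hπ] with x hx
  rw [← mem ⟨A, hA⟩, ← mem ⟨A, hA⟩, ← hx]
  rfl

end RandomSurj

open Opposite

/-! ### Atomic sheaves on `CSur` -/

namespace CSur

variable (P : CSur.{u}ᵒᵖ ⥤ Type u)

/-- A covering sieve contains some `f`, and descent along `f` yields the amalgamation. Its
restriction along any other member is checked on an Ore square, where injectivity suffices. -/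
theorem isSheaf_atomic_of_descent
    (inj : ∀ {Y X : CSur.{u}} (f : Y ⟶ X), Function.Injective (P.map f.op))
    (desc : ∀ {Y X : CSur.{u}} (f : Y ⟶ X) (y : P.obj (op Y)),
      (∀ {Z : CSur.{u}} (g h : Z ⟶ Y), g ≫ f = h ≫ f → P.map g.op y = P.map h.op y) →
        ∃ x, P.map f.op x = y) :
    Presheaf.IsSheaf (GrothendieckTopology.atomic CSur.rightOre.{u}) P := by
  rw [isSheaf_iff_isSheaf_of_type]
  rintro X S ⟨Y, f, hf⟩ x hx
  obtain ⟨t, ht⟩ := desc f (x f hf) fun g h e => hx g h hf hf e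
  refine ⟨t, fun W k hk => ?_, fun t' ht' => inj f ((ht' f hf).trans ht.symm)⟩
  obtain ⟨Z, a, b, e⟩ := rightOre k f
  apply inj a
  rw [hx a b hk hf e, ← ht, ← Functor.map_comp_apply, ← Functor.map_comp_apply, ← op_comp,
    ← op_comp, e]

variable {P}

theorem existsUnique_descent
    (hP : Presheaf.IsSheaf (GrothendieckTopology.atomic CSur.rightOre.{u}) P)
    {Y X : CSur.{u}} (f : Y ⟶ X) (y : P.obj (op Y))
    (hy : ∀ {Z : CSur.{u}} (g h : Z ⟶ Y), g ≫ f = h ≫ f → P.map g.op y = P.map h.op y) :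
    ∃! x, P.map f.op x = y := by
  rw [isSheaf_iff_isSheaf_of_type] at hP
  have h1 : (Presieve.ofArrows (fun _ : Unit => Y) fun _ => f).IsSheafFor P := by
    rw [Presieve.isSheafFor_iff_generate]
    exact hP _ ⟨Y, f, Sieve.le_generate _ _ _ (Presieve.ofArrows.mk ())⟩
  obtain ⟨t, ht, hu⟩ := (Presieve.isSheafFor_arrows_iff P _).1 h1 (fun _ => y)
    fun _ _ Z g h e => hy g h e
  exact ⟨t, ht (), fun t' ht' => hu t' fun _ => ht'⟩

theorem map_injective
    (hP : Presheaf.IsSheaf (GrothendieckTopology.atomic CSur.rightOre.{u}) P)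
    {Y X : CSur.{u}} (f : Y ⟶ X) : Function.Injective (P.map f.op) := fun x x' h =>
  (existsUnique_descent hP f (P.map f.op x) fun g h e => by
    rw [← Functor.map_comp_apply, ← Functor.map_comp_apply, ← op_comp, ← op_comp, e]).unique rfl
    h.symm

end CSur

/-! ### Random surjections as a functor on `CSur` -/

namespace RandomSurj

/-- Postcomposition with a surjection, as an equivariant function. -/
def mapHom {S T : CSur.{u}} (f : S ⟶ T) :
    RandomSurj S.carrier →[AutIᵐᵒᵖ] RandomSurj T.carrier where
  toFun := map f.1 f.2
  map_smul' := map_smul_eq f.1 f.2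

theorem mapHom_id {S : CSur.{u}} (p : RandomSurj S.carrier) : mapHom (𝟙 S) p = p := map_id p

theorem mapHom_comp {S T U : CSur.{u}} (f : S ⟶ T) (g : T ⟶ U) (p : RandomSurj S.carrier) :
    mapHom (f ≫ g) p = mapHom g (mapHom f p) := (map_map f.1 f.2 g.1 g.2 p).symm

theorem mapHom_surjective {S T : CSur.{u}} (f : S ⟶ T) : Function.Surjective (mapHom f) :=
  map_surjective f.1 f.2

theorem eq_of_mapHom_eq {S T : CSur.{u}} {f g : S ⟶ T} {p : RandomSurj S.carrier}
    (h : mapHom f p = mapHom g p) : f = g := 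
  Subtype.ext (eq_of_map_eq (hf := f.2) (hg := g.2) h)

theorem exists_span {S T : CSur.{u}} (p : RandomSurj S.carrier) (q : RandomSurj T.carrier) :
    ∃ (R : CSur.{u}) (r : RandomSurj R.carrier) (f : R ⟶ S) (g : R ⟶ T),
      mapHom f r = p ∧ mapHom g r = q := by
  obtain ⟨R, _, _, r, f, hf, g, hg, h⟩ := exists_refinement p q
  exact ⟨⟨R⟩, r, ⟨f, hf⟩, ⟨g, hg⟩, h⟩

variable {S : CSur.{u}} {X : Type*} [MulAction AutIᵐᵒᵖ X]

theorem hom_ext {φ ψ : RandomSurj S.carrier →[AutIᵐᵒᵖ] X} (p : RandomSurj S.carrier)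
    (h : φ p = ψ p) : φ = ψ := by
  ext q
  obtain ⟨g, rfl⟩ := exists_smul_eq p q
  rw [map_smul, map_smul, h]

/-- Orbit-stabilizer: `RandomSurj S` is the orbit of `p`, so `g • p ↦ g • x` is well defined. -/
theorem exists_hom (p : RandomSurj S.carrier) (x : X)
    (h : ∀ g : AutIᵐᵒᵖ, g • p = p → g • x = x) :
    ∃ φ : RandomSurj S.carrier →[AutIᵐᵒᵖ] X, φ p = x := by
  choose g hg using exists_smul_eq p
  have key : ∀ a b : AutIᵐᵒᵖ, a • p = b • p → a • x = b • x := fun a b e => by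
    rw [← inv_smul_eq_iff, smul_smul] at e ⊢
    exact h _ e
  refine ⟨⟨fun q => g q • x, fun a q => ?_⟩, ?_⟩
  · rw [smul_smul]
    refine key _ _ ?_
    rw [hg, mul_smul, hg]
    rfl
  · exact (key _ 1 (by rw [hg, one_smul])).trans (one_smul _ _)

end RandomSurj

/-! ### The nerve functor: sheaf condition and full faithfulness -/

namespace DiscreteProbNominalSet

open RandomSurj

/-- The open stabilizer of `x` contains some `Fix P`, which contains the stabilizer of a random
surjection. -/
theorem exists_hom_apply_eq (X : DiscreteProbNominalSet.{u}) (x : X.carrier) :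
    ∃ (S : CSur.{u}) (p : RandomSurj S.carrier) (φ : RandomSurj S.carrier →[AutIᵐᵒᵖ] X.carrier),
      φ p = x := by
  obtain ⟨P, hP⟩ := X.isOpen_stabilizer x 1 (one_smul _ x)
  obtain ⟨S, _, _, p, hp⟩ := exists_stabilizer_le_fix.{u} P
  refine ⟨⟨S⟩, p, exists_hom (S := ⟨S⟩) p x fun g hg => ?_⟩
  have := hP g.unop (hp g.unop hg)
  rwa [one_mul] at this

/-- The presheaf of equivariant functions from random surjections. -/
def nerveObj (X : DiscreteProbNominalSet.{u}) : CSur.{u}ᵒᵖ ⥤ Type u where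
  obj S := RandomSurj S.unop.carrier →[AutIᵐᵒᵖ] X.carrier
  map f := ↾ fun φ => φ.comp (mapHom f.unop)
  map_id S := ConcreteCategory.hom_ext _ _ fun φ => MulActionHom.ext
    (f := (φ : RandomSurj S.unop.carrier →[AutIᵐᵒᵖ] X.carrier).comp (mapHom (𝟙 S.unop)))
    fun p => congrArg φ (mapHom_id p)
  map_comp f g := ConcreteCategory.hom_ext _ _ fun φ => MulActionHom.ext
    (f := (φ : RandomSurj _ →[AutIᵐᵒᵖ] X.carrier).comp (mapHom (g.unop ≫ f.unop)))
    fun p => congrArg φ (mapHom_comp g.unop f.unop p)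

theorem isSheaf_nerveObj (X : DiscreteProbNominalSet.{u}) :
    Presheaf.IsSheaf (GrothendieckTopology.atomic CSur.rightOre.{u}) X.nerveObj := by
  refine CSur.isSheaf_atomic_of_descent _ (fun {S T} f φ ψ h => ?_) fun {S T} f φ hφ => ?_
  · refine MulActionHom.ext fun q => ?_
    obtain ⟨p, rfl⟩ := mapHom_surjective f q
    exact DFunLike.congr_fun (F := RandomSurj S.carrier →[AutIᵐᵒᵖ] X.carrier) h p
  · change RandomSurj S.carrier →[AutIᵐᵒᵖ] X.carrier at φ
    -- On a common refinement `r`, the two legs agree after composing with `f` because `r` is epi,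
    -- so the compatibility hypothesis on `φ` applies.
    have key : ∀ p q, mapHom f p = mapHom f q → φ p = φ q := by
      intro p q h
      obtain ⟨R, r, a, b, rfl, rfl⟩ := exists_span p q
      rw [← mapHom_comp, ← mapHom_comp] at h
      exact DFunLike.congr_fun (F := RandomSurj R.carrier →[AutIᵐᵒᵖ] X.carrier)
        (hφ a b (eq_of_mapHom_eq h)) r
    obtain ⟨p⟩ := RandomSurj.nonempty (S := S.carrier)
    obtain ⟨ψ, hψ⟩ := exists_hom (mapHom f p) (φ p) fun g hg => by
      rw [← map_smul] at hg ⊢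
      exact key _ _ hg
    exact ⟨ψ, RandomSurj.hom_ext p hψ⟩

/-- The nerve of discrete probability nominal sets along random surjections. -/
def nerve : DiscreteProbNominalSet.{u} ⥤ AtomicSheafCSur.{u} where
  obj X := ⟨X.nerveObj, X.isSheaf_nerveObj⟩
  map {X Y} a := ⟨{ app S := ↾ fun φ : RandomSurj S.unop.carrier →[AutIᵐᵒᵖ] X.carrier =>
    MulActionHom.comp (X := RandomSurj S.unop.carrier) (Y := X.carrier) (Z := Y.carrier) a φ }⟩

theorem nerve_map_apply {X Y : DiscreteProbNominalSet.{u}} (a : X ⟶ Y) {S : CSur.{u}}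
    (φ : RandomSurj S.carrier →[AutIᵐᵒᵖ] X.carrier) (p : RandomSurj S.carrier) :
    DFunLike.coe (F := RandomSurj S.carrier →[AutIᵐᵒᵖ] Y.carrier)
      ((nerve.map a).hom.app (op S) φ) p =
    DFunLike.coe (F := X.carrier →[AutIᵐᵒᵖ] Y.carrier) a (φ p) := rfl

instance : nerve.{u}.Faithful where
  map_injective {X Y} a b h := by
    refine MulActionHom.ext (f := a) (g := b) fun x => ?_
    obtain ⟨S, p, φ, rfl⟩ := X.exists_hom_apply_eq x
    rw [← nerve_map_apply, ← nerve_map_apply, h]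

/-- The action of a map of nerves on equivariant functions. -/
def nerveApp {X Y : DiscreteProbNominalSet.{u}} (η : X.nerveObj ⟶ Y.nerveObj) {S : CSur.{u}}
    (φ : RandomSurj S.carrier →[AutIᵐᵒᵖ] X.carrier) : RandomSurj S.carrier →[AutIᵐᵒᵖ] Y.carrier :=
  η.app (op S) φ

theorem nerveApp_comp {X Y : DiscreteProbNominalSet.{u}} (η : X.nerveObj ⟶ Y.nerveObj)
    {S T : CSur.{u}} (f : S ⟶ T) (φ : RandomSurj T.carrier →[AutIᵐᵒᵖ] X.carrier) :
    nerveApp η (φ.comp (mapHom f)) = (nerveApp η φ).comp (mapHom f) :=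
  NatTrans.naturality_apply η f.op φ

/-- On a common refinement the two equivariant maps agree at one point, hence everywhere, and
naturality transports this through `η`. Thus `η` induces a well-defined map on points, which is what
fullness needs. -/
theorem nerveApp_congr {X Y : DiscreteProbNominalSet.{u}} (η : X.nerveObj ⟶ Y.nerveObj)
    {S T : CSur.{u}} {φ : RandomSurj S.carrier →[AutIᵐᵒᵖ] X.carrier} {p : RandomSurj S.carrier}
    {ψ : RandomSurj T.carrier →[AutIᵐᵒᵖ] X.carrier} {q : RandomSurj T.carrier} (h : φ p = ψ q) :
    nerveApp η φ p = nerveApp η ψ q := by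
  obtain ⟨R, r, f, g, rfl, rfl⟩ := exists_span p q
  have : φ.comp (mapHom f) = ψ.comp (mapHom g) := RandomSurj.hom_ext r h
  have h' := congrArg (nerveApp η) this
  rw [nerveApp_comp, nerveApp_comp] at h'
  exact DFunLike.congr_fun h' r

instance : nerve.{u}.Full where
  map_surjective {X Y} η := by
    choose S p φ h using X.exists_hom_apply_eq
    let a : X.carrier →[AutIᵐᵒᵖ] Y.carrier :=
      { toFun x := nerveApp η.hom (φ x) (p x)
        map_smul' g x := by
          change _ = g • _
          rw [← map_smul]
          refine nerveApp_congr _ ?_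
          rw [map_smul, h, h] }
    refine ⟨a, Sheaf.hom_ext (NatTrans.ext (funext fun T => ?_))⟩
    refine ConcreteCategory.hom_ext _ _ fun ψ => MulActionHom.ext
      (g := nerveApp η.hom (S := T.unop) ψ) fun q => ?_
    exact nerveApp_congr η.hom (h _)

end DiscreteProbNominalSet

/-! ### The stalk of a presheaf at the unit interval -/

namespace CSur

open RandomSurj

variable (F : CSur.{u}ᵒᵖ ⥤ Type u)

/-- Pairs of a random surjection and a section, identified when they agree on a common
refinement. -/
def stalkSetoid : Setoid (Σ S : CSur.{u}, RandomSurj S.carrier × F.obj (op S)) where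
  r x y := ∃ (R : CSur.{u}) (r : RandomSurj R.carrier) (f : R ⟶ x.1) (g : R ⟶ y.1),
    mapHom f r = x.2.1 ∧ mapHom g r = y.2.1 ∧ F.map f.op x.2.2 = F.map g.op y.2.2
  iseqv := by
    refine ⟨fun x => ⟨x.1, x.2.1, 𝟙 _, 𝟙 _, mapHom_id _, mapHom_id _, rfl⟩, ?_, ?_⟩
    · rintro x y ⟨R, r, f, g, hf, hg, h⟩
      exact ⟨R, r, g, f, hg, hf, h.symm⟩
    · rintro x y z ⟨R, r, f, g, hf, hg, h⟩ ⟨R', r', f', g', hf', hg', h'⟩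
      obtain ⟨Q, q, a, b, rfl, rfl⟩ := exists_span r r'
      refine ⟨Q, q, a ≫ f, b ≫ g', ?_, ?_, ?_⟩
      · rw [mapHom_comp, hf]
      · rw [mapHom_comp, hg']
      -- The two middle legs agree because `q` is epi.
      · have e : a ≫ g = b ≫ f' := eq_of_mapHom_eq (p := q) (by
          rw [mapHom_comp, mapHom_comp, hg, hf'])
        rw [op_comp, op_comp, Functor.map_comp_apply, Functor.map_comp_apply, h, ← h',
          ← Functor.map_comp_apply, ← Functor.map_comp_apply, ← op_comp, ← op_comp, e]

/-- The stalk of a presheaf on `CSur` at the unit interval. -/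
def Stalk : Type (u + 1) := Quotient (stalkSetoid F)

variable {F}

/-- The germ of a section along a random surjection. -/
def germ {S : CSur.{u}} (p : RandomSurj S.carrier) (s : F.obj (op S)) : Stalk F :=
  Quotient.mk (stalkSetoid F) ⟨S, p, s⟩

theorem germ_eq_germ {S T : CSur.{u}} {p : RandomSurj S.carrier} {s : F.obj (op S)}
    {q : RandomSurj T.carrier} {t : F.obj (op T)} :
    germ p s = germ q t ↔ ∃ (R : CSur.{u}) (r : RandomSurj R.carrier) (f : R ⟶ S) (g : R ⟶ T),
      mapHom f r = p ∧ mapHom g r = q ∧ F.map f.op s = F.map g.op t :=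
  Quotient.eq (r := stalkSetoid F)

theorem germ_map {S T : CSur.{u}} (f : S ⟶ T) (p : RandomSurj S.carrier) (t : F.obj (op T)) :
    germ p (F.map f.op t) = germ (mapHom f p) t :=
  germ_eq_germ.2 ⟨S, p, 𝟙 S, f, mapHom_id p, rfl, by simp⟩

theorem exists_germ_eq (x : Stalk F) :
    ∃ (S : CSur.{u}) (p : RandomSurj S.carrier) (s : F.obj (op S)), x = germ p s := by
  induction x using Quotient.inductionOn with | _ x
  exact ⟨x.1, x.2.1, x.2.2, rfl⟩

instance : Small.{u} (Stalk F) := by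
  -- Every object is a quotient of this one, and random surjections lift, so germs along it exhaust
  -- the stalk.
  let N : CSur.{u} := ⟨ULift.{u} ℕ⟩
  refine small_of_surjective (α := RandomSurj N.carrier × F.obj (op N))
    (f := fun w => germ w.1 w.2) fun x => ?_
  obtain ⟨S, p, s, rfl⟩ := exists_germ_eq x
  obtain ⟨e, he⟩ := exists_surjective_nat S.carrier
  let f : N ⟶ S := ⟨e ∘ ULift.down, he.comp ULift.down_surjective⟩
  obtain ⟨q, rfl⟩ := mapHom_surjective f p
  exact ⟨(q, F.map f.op s), germ_map f q s⟩

instance : MulAction AutIᵐᵒᵖ (Stalk F) where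
  smul g := Quotient.map (sa := stalkSetoid F) (sb := stalkSetoid F)
    (fun x => ⟨x.1, g • x.2.1, x.2.2⟩) (by
      rintro x y ⟨R, r, a, b, ha, hb, h⟩
      exact ⟨R, g • r, a, b, by rw [map_smul, ha], by rw [map_smul, hb], h⟩)
  one_smul x := by
    obtain ⟨S, p, s, rfl⟩ := exists_germ_eq x
    exact congrArg (fun q => germ q s) (one_smul _ p)
  mul_smul g h x := by
    obtain ⟨S, p, s, rfl⟩ := exists_germ_eq x
    exact congrArg (fun q => germ q s) (mul_smul g h p)

theorem smul_germ {S : CSur.{u}} (g : AutIᵐᵒᵖ) (p : RandomSurj S.carrier) (s : F.obj (op S)) :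
    g • germ p s = germ (g • p) s := rfl

/-- The two legs witnessing equality of germs coincide, since random surjections are epi;
restriction along a single map is injective. -/
theorem germ_injective
    (hF : Presheaf.IsSheaf (GrothendieckTopology.atomic CSur.rightOre.{u}) F)
    {S : CSur.{u}} (p : RandomSurj S.carrier) :
    Function.Injective fun s : F.obj (op S) => germ p s := by
  intro s t h
  obtain ⟨R, r, f, g, hf, hg, e⟩ := germ_eq_germ.1 h
  obtain rfl : f = g := eq_of_mapHom_eq (hf.trans hg.symm)
  exact map_injective hF f e

/-- A germ whose stabilizer contains that of `p` comes from a section along `p`. -/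
theorem exists_germ_eq_of_stabilizer
    (hF : Presheaf.IsSheaf (GrothendieckTopology.atomic CSur.rightOre.{u}) F)
    {S : CSur.{u}} (p : RandomSurj S.carrier) (x : Stalk F)
    (h : ∀ g : AutIᵐᵒᵖ, g • p = p → g • x = x) : ∃ s : F.obj (op S), germ p s = x := by
  obtain ⟨T, q, t, rfl⟩ := exists_germ_eq x
  obtain ⟨R, r, f, k, rfl, rfl⟩ := exists_span p q
  rw [← germ_map] at h ⊢
  generalize F.map k.op t = t at h ⊢
  -- To compare the restrictions of `t` along `a` and `b`, move `z` so that `a` sends it to `r`, and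
  -- let `g'` carry `r` to its image under `b`. As `a ≫ f = b ≫ f`, `g'` fixes the image of `r`
  -- under `f`, hence the germ of `t`; germs along `g • z` then separate sections.
  obtain ⟨s, rfl, -⟩ := existsUnique_descent hF f t fun {Z} a b e => by
    obtain ⟨z⟩ := RandomSurj.nonempty (S := Z.carrier)
    obtain ⟨g, hg⟩ := exists_smul_eq (mapHom a z) r
    obtain ⟨g', hg'⟩ := exists_smul_eq r (mapHom b (g • z))
    rw [← map_smul] at hg
    refine germ_injective hF (g • z) ?_
    change germ _ _ = germ _ _
    rw [germ_map, germ_map, hg, ← hg', ← smul_germ]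
    refine (h g' ?_).symm
    rw [← map_smul, hg', ← mapHom_comp, ← e, mapHom_comp, hg]
  exact ⟨s, (germ_map f r s).symm⟩

variable (F) in
/-- The stalk as a discrete probability nominal set. -/
noncomputable def stalk : DiscreteProbNominalSet.{u} :=
  letI : MulAction AutIᵐᵒᵖ (Shrink.{u} (Stalk F)) := (equivShrink (Stalk F)).symm.mulAction _
  { carrier := Shrink.{u} (Stalk F)
    isOpen_stabilizer := by
      intro x π hπ
      obtain ⟨S, p, s, hx⟩ := exists_germ_eq ((equivShrink (Stalk F)).symm x)
      obtain ⟨P, hP⟩ := exists_fix_le_stabilizer p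
      refine ⟨P, fun σ hσ => ?_⟩
      change MulOpposite.op (π * σ) • x = x
      -- For the right action, `π * σ` acts by `π` first and then by `σ`, each of which fixes `x`.
      rw [MulOpposite.op_mul, mul_smul, show MulOpposite.op π • x = x from hπ]
      change equivShrink _ (MulOpposite.op σ • (equivShrink (Stalk F)).symm x) = x
      rw [hx, smul_germ, hP σ hσ, ← hx, Equiv.apply_symm_apply] }

variable (F) in
/-- The underlying set of the stalk is equivariantly in bijection with the stalk. -/
noncomputable def stalkEquiv : Stalk F ≃ (stalk F).carrier := equivShrink (Stalk F)

theorem stalkEquiv_smul (g : AutIᵐᵒᵖ) (x : Stalk F) :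
    stalkEquiv F (g • x) = g • stalkEquiv F x := by
  change _ = equivShrink _ (g • (equivShrink (Stalk F)).symm (equivShrink (Stalk F) x))
  rw [Equiv.symm_apply_apply]
  rfl

/-- A section of `F` gives an equivariant function to the stalk, taking germs. -/
noncomputable def germHom {S : CSur.{u}} (s : F.obj (op S)) :
    RandomSurj S.carrier →[AutIᵐᵒᵖ] (stalk F).carrier where
  toFun p := stalkEquiv F (germ p s)
  map_smul' g p := by
    rw [← smul_germ, stalkEquiv_smul]
    rfl

theorem germHom_bijective
    (hF : Presheaf.IsSheaf (GrothendieckTopology.atomic CSur.rightOre.{u}) F) (S : CSur.{u}) :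
    Function.Bijective (germHom (F := F) (S := S)) := by
  obtain ⟨p⟩ := RandomSurj.nonempty (S := S.carrier)
  refine ⟨fun s t h => germ_injective hF p ((stalkEquiv F).injective (DFunLike.congr_fun h p)),
    fun φ => ?_⟩
  obtain ⟨s, hs⟩ := exists_germ_eq_of_stabilizer hF p ((stalkEquiv F).symm (φ p)) fun g hg => by
    apply (stalkEquiv F).injective
    rw [stalkEquiv_smul, Equiv.apply_symm_apply, ← map_smul, hg]
  exact ⟨s, RandomSurj.hom_ext p ((congrArg _ hs).trans (Equiv.apply_symm_apply _ _))⟩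

/-- An atomic sheaf is the nerve of its stalk. -/
noncomputable def isoNerveStalk (F : AtomicSheafCSur.{u}) :
    F ≅ DiscreteProbNominalSet.nerve.obj (stalk F.obj) :=
  ObjectProperty.isoMk _ (NatIso.ofComponents
    (fun S => (Equiv.ofBijective _ (germHom_bijective F.property S.unop)).toIso)
    fun f => ConcreteCategory.hom_ext _ _ fun s => MulActionHom.ext
      (f := germHom (F.obj.map f s)) (g := (germHom s).comp (mapHom f.unop)) fun p => congrArg (stalkEquiv F.obj) (germ_map f.unop p s))

end CSur

instance : DiscreteProbNominalSet.nerve.{u}.EssSurj where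
  mem_essImage F := ⟨_, ⟨(CSur.isoNerveStalk F).symm⟩⟩

instance : DiscreteProbNominalSet.nerve.{u}.IsEquivalence where

/-- The category of atomic sheaves on `CSur` is equivalent to the category of discrete
probability nominal sets. -/
theorem mainTheorem3 : Nonempty (AtomicSheafCSur.{u} ≌ DiscreteProbNominalSet.{u}) :=
  ⟨DiscreteProbNominalSet.nerve.asEquivalence.symm⟩
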